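/- **Model.** A *team* $\mathcal A$ is a finite non-empty set of deterministic finite Mealy automata (*agents*) moving on the discrete half-line $v_0,v_1,v_2,\dots$, where node $v_j$ represents $j\in\mathbb N$ and $v_0$ is the *root*. The root has degree $1$ and all other nodes have degree $2$. All agents share a finite state set $Q$ with a special state $STOP$, a transition function $\delta: Q\times I\to Q$ and an output function $\lambda: Q\times I\to\{*,0,1\}$, where $I=\{1,2\}\times 2^{Q}$. They have pairwise distinct starting states, all different from $STOP$. The computation proceeds in synchronous rounds. An agent in state $S\neq STOP$ receives the input $(deg,Z)\in I$, where $deg$ is the degree of its node and $Z$ is the set of states of the other agents at that node. It goes to state $\delta(S,(deg,Z))$ and, according to $\lambda(S,(deg,Z))$, stays idle ($*$), moves right ($0$) or moves left ($1$; at the root it then stays). An agent in state $STOP$ has terminated: it neither moves nor changes state. The *slice* of an agent is the set of states other than $STOP$ that can be reached from its starting state by applying $\delta$ with arbitrary inputs. For $n\ge 1$, a team *performs a synchronized computation* of $f:\mathbb N^n\to\mathbb N$ if there are a partition of its agents into non-empty sets $\mathcal A_1,\dots,\mathcal A_n$ and agents $m_i\in\mathcal A_i$ ($1\le i\le n$),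 none of these depending on the arguments, such that for all $x_1,\dots,x_n\in\mathbb N$, when the computation starts with every agent in its starting state and all agents of $\mathcal A_i$ at node $x_i$ for each $i$, * from some round on, all agents are at node $f(x_1,\dots,x_n)$ in state $STOP$; and * in some round, $m_1,\dots,m_n$ are all at the root. **Theorem 4.1.** Let $k\ge 1$, and suppose that some teams perform synchronized computations of $h:\mathbb N^k\to\mathbb N$ and $g:\mathbb N^{k+2}\to\mathbb N$, respectively. Let $f:\mathbb N^{k+1}\to\mathbb N$ be obtained from $h$ and $g$ by primitive recursion, that is, $$f(x_1,\dots,x_k,0)=h(x_1,\dots,x_k),\qquad f(x_1,\dots,x_k,y+1)=g(x_1,\dots,x_k,y,f(x_1,\dots,x_k,y)).$$ Then there exists a team, whose different agents have disjoint slices, that performs a synchronized computation of $f$. -/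

import Mathlib

/-- The degree of a node of the half-line: the root has degree one, every other node degree two. -/
inductive NodeDegree : Type
  | one
  | two

/-- The output alphabet `{*, 0, 1}`: stay idle, take port 0 (go right), take port 1 (go left). -/
inductive Output : Type
  | stay
  | port0
  | port1

/-- Node `v` of the discrete half-line is identified with the natural number `v`; the root is `0`. -/
def nodeDegree : ℕ → NodeDegree
  | 0 => NodeDegree.one
  | _ + 1 => NodeDegree.two

/-- The node reached from node `v` with a given output. The root has no port 1; an agent at the
root whose output is 1 stays there. -/
def destination (v : ℕ) : Output → ℕ
  | Output.stay => v
  | Output.port0 => v + 1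
  | Output.port1 => v - 1

/-- A finite team of deterministic finite Mealy automata. All agents share the state set, the
transition function and the output function, and differ by their starting states. The special state `halt` is the terminating state STOP. An input is the
degree of the current node together with the set of states of the other agents at that node. -/
structure Team : Type 1 where
  Agent : Type
  State : Type
  finite_agent : Finite Agent
  finite_state : Finite State
  halt : State
  start : Agent → State
  start_injective : Function.Injective start
  start_ne_halt : ∀ a, start a ≠ halt
  transition : State → NodeDegree × Set State → State
  output : State → NodeDegree × Set State → Output

namespace Team

/-- The positions and the states of all agents in a round. -/
structure Config (A : Team) : Type where
  pos : A.Agent → ℕ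
  state : A.Agent → A.State

/-- What agent `a` perceives: the degree of its node and the set of states of the other agents
that are at the same node. -/
def input (A : Team) (c : A.Config) (a : A.Agent) : NodeDegree × Set A.State :=
  (nodeDegree (c.pos a), {S | ∃ b, b ≠ a ∧ c.pos b = c.pos a ∧ c.state b = S})

open Classical in
/-- One synchronous round: all agents that have not stopped act simultaneously, and agents in
state `halt` have terminated. -/
noncomputable def step (A : Team) (c : A.Config) : A.Config where
  pos a := if c.state a = A.halt then c.pos a
    else destination (c.pos a) (A.output (c.state a) (A.input c a))
  state a := if c.state a = A.halt then A.halt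
    else A.transition (c.state a) (A.input c a)

/-- The configuration in round `t` (from `t = 0`) of the computation in which agent `a` starts at
node `loc a`. -/
noncomputable def run (A : Team) (loc : A.Agent → ℕ) : ℕ → A.Config
  | 0 => { pos := loc, state := A.start }
  | t + 1 => A.step (A.run loc t)

/-- With agents divided into groups by `grp`, the team computes `f`: started with group `i` at
node `x i`, the agents all end up at node `f x` in state `halt`. -/
def ComputesWith (A : Team) {k : ℕ} (grp : A.Agent → Fin k) (f : (Fin k → ℕ) → ℕ) : Prop :=
  ∀ x : Fin k → ℕ, ∃ T : ℕ, ∀ a : A.Agent,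
    (A.run (fun b => x (grp b)) T).pos a = f x ∧
    (A.run (fun b => x (grp b)) T).state a = A.halt

/-- The team performs a synchronized computation of `f`: for some partition of its agents into `k`
non-empty groups, one per argument, it computes `f`, and there are synchronizers, one in each group and chosen once for all arguments, that are in every computation all at the root
in some common round. -/
def SynchronizedComputes (A : Team) {k : ℕ} (f : (Fin k → ℕ) → ℕ) : Prop :=
  ∃ grp : A.Agent → Fin k, Function.Surjective grp ∧ A.ComputesWith grp f ∧
    ∃ m : Fin k → A.Agent, (∀ i, grp (m i) = i) ∧
      ∀ x : Fin k → ℕ, ∃ t : ℕ, ∀ i, (A.run (fun b => x (grp b)) t).pos (m i) = 0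

/-- The states that the transition function allows agent `a` to enter. -/
inductive CanBe (A : Team) (a : A.Agent) : A.State → Prop
  | start : CanBe A a (A.start a)
  | next (S : A.State) (I : NodeDegree × Set A.State) :
      CanBe A a S → S ≠ A.halt → CanBe A a (A.transition S I)

/-- The slice of agent `a`: the states other than `halt` in which it can be. -/
def slice (A : Team) (a : A.Agent) : Set A.State :=
  {S | A.CanBe a S ∧ S ≠ A.halt}

/-- Different agents have disjoint slices, so that agents can recognize each other by name. -/
def DisjointSlices (A : Team) : Prop :=
  ∀ a b : A.Agent, a ≠ b → Disjoint (A.slice a) (A.slice b)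

end Team

/-- The tuple `(x, y)` obtained by appending the entry `y` to `x`. -/
def appendEntry {k : ℕ} (x : Fin k → ℕ) (y : ℕ) : Fin (k + 1) → ℕ :=
  Fin.snoc (α := fun _ => ℕ) x y

/-- The value at `(x, y)` of the function obtained by primitive recursion on `y`. -/
def primitiveRecursionAux {k : ℕ} (h : (Fin k → ℕ) → ℕ) (g : (Fin (k + 2) → ℕ) → ℕ)
    (x : Fin k → ℕ) : ℕ → ℕ
  | 0 => h x
  | y + 1 => g (appendEntry (appendEntry x y) (primitiveRecursionAux h g x y))

/-- The function obtained by primitive recursion from `h` and `g`. Its last argument is the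
recursion variable. -/
def primitiveRecursion {k : ℕ} (h : (Fin k → ℕ) → ℕ) (g : (Fin (k + 2) → ℕ) → ℕ)
    (z : Fin (k + 1) → ℕ) : ℕ :=
  primitiveRecursionAux h g (fun i => z i.castSucc) (z (Fin.last k))

theorem primitiveRecursion_zero {k : ℕ} (h : (Fin k → ℕ) → ℕ) (g : (Fin (k + 2) → ℕ) → ℕ)
    (x : Fin k → ℕ) : primitiveRecursion h g (appendEntry x 0) = h x := by
  simp [primitiveRecursion, appendEntry, primitiveRecursionAux]

theorem primitiveRecursion_succ {k : ℕ} (h : (Fin k → ℕ) → ℕ) (g : (Fin (k + 2) → ℕ) → ℕ)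
    (x : Fin k → ℕ) (y : ℕ) :
    primitiveRecursion h g (appendEntry x (y + 1)) =
      g (appendEntry (appendEntry x y) (primitiveRecursion h g (appendEntry x y))) := by
  simp [primitiveRecursion, appendEntry, primitiveRecursionAux]

/-! The proof passes through an intermediate model: a finite control that moves tokens on the
half-line, one at a time. Numbers are token positions, and the only tests are whether a token is at
the root and which tokens share its node.

Every such program is executed by a team with disjoint slices (`synchronizedComputes_toTeam`). Each
token is an agent, and one further agent carries the control state. It walks from the root to the
token to be visited, both evaluate the same transition there, the token moves, and the controller
returns. Initially all tokens except those holding the arguments are gathered at the root; this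
yields the common root visit of the synchronizers.

Conversely, a program can run any given team as a subroutine (`exec_call`). Tokens record the
positions of the agents and the finite control remembers their states; a synchronous round is
serialized by letting all agents observe before any of them moves. The agents start from copies of
the arguments, so the arguments survive the call.

With such subroutines for `h` and `g`, primitive recursion is a loop in which a counter token climbs
from the root until it meets the recursion argument (`exec_recursionProgram`). -/

/-! ### Token programs and their combinators -/

/-- A finite controller that manipulates tokens placed on the half-line. In a control state it
visits a token, observes the degree of its node and the set of tokens there, moves the token and
passes to another control state or exits. Runs are entered with data in `X` and left with data
in `Y`. -/
structure TokenProgram (τ X Y : Type) : Type 1 where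
  State : Type
  finite_state : Finite State
  entry : X → State
  target : State → τ
  next : State → NodeDegree × Set τ → (State ⊕ Y) × Output

/-- What is observed at the node of token `t`. -/
def observe {τ : Type} (p : τ → ℕ) (t : τ) : NodeDegree × Set τ :=
  (nodeDegree (p t), {u | p u = p t})

open Classical in
/-- The placement after token `t` moves according to `o`. -/
noncomputable def moveToken {τ : Type} (p : τ → ℕ) (t : τ) (o : Output) : τ → ℕ :=
  Function.update p t (destination (p t) o)

section moveToken
variable {τ : Type} (p : τ → ℕ) (t : τ)

@[simp] theorem moveToken_stay : moveToken p t Output.stay = p := by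
  simp [moveToken, destination]

@[simp] theorem moveToken_self (o : Output) : moveToken p t o t = destination (p t) o := by
  simp [moveToken]

theorem moveToken_of_ne (o : Output) {u : τ} (h : u ≠ t) : moveToken p t o u = p u := by
  simp [moveToken, h]

end moveToken

namespace TokenProgram

variable {τ X Y Z W : Type}

/-- Runs of a program, from a control state or an exit value to an exit value. -/
inductive Reach (F : TokenProgram τ X Y) : F.State ⊕ Y → (τ → ℕ) → Y → (τ → ℕ) → Prop
  | exit (y : Y) (p : τ → ℕ) : Reach F (Sum.inr y) p y p
  | visit (s : F.State) (p : τ → ℕ) (y : Y) (p' : τ → ℕ) :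
      Reach F (F.next s (observe p (F.target s))).1
        (moveToken p (F.target s) (F.next s (observe p (F.target s))).2) y p' →
      Reach F (Sum.inl s) p y p'

/-- Entered with `x` at placement `p`, the program exits with `y` at placement `p'`. -/
def Exec (F : TokenProgram τ X Y) (x : X) (p : τ → ℕ) (y : Y) (p' : τ → ℕ) : Prop :=
  F.Reach (Sum.inl (F.entry x)) p y p'

/-- The program that visits a single token. -/
def visitOnce [Finite X] (t : X → τ) (f : X → NodeDegree × Set τ → Y × Output) :
    TokenProgram τ X Y where
  State := X
  finite_state := inferInstance
  entry := id
  target := t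
  next x o := (Sum.inr (f x o).1, (f x o).2)

theorem exec_visitOnce [Finite X] (t : X → τ) (f : X → NodeDegree × Set τ → Y × Output)
    (x : X) (p : τ → ℕ) :
    (visitOnce t f).Exec x p (f x (observe p (t x))).1
      (moveToken p (t x) (f x (observe p (t x))).2) :=
  Reach.visit (F := visitOnce t f) x p _ _ (Reach.exit _ _)

theorem exec_visitOnce_of_eq [Finite X] {t : X → τ} {f : X → NodeDegree × Set τ → Y × Output}
    {x : X} {p : τ → ℕ} {y : Y} {o : Output} (h : f x (observe p (t x)) = (y, o)) :
    (visitOnce t f).Exec x p y (moveToken p (t x) o) := by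
  have := exec_visitOnce t f x p
  rwa [h] at this

/-- Composition: an exit value of `F` is sent by `κ` to an entry value of `G` or to an exit. -/
def chain (F : TokenProgram τ X Y) (κ : Y → Z ⊕ W) (G : TokenProgram τ Z W) :
    TokenProgram τ X W where
  State := F.State ⊕ G.State
  finite_state := by
    have := F.finite_state
    have := G.finite_state
    infer_instance
  entry x := Sum.inl (F.entry x)
  target := Sum.elim F.target G.target
  next := Sum.elim
    (fun s o => (Sum.elim (fun s' => Sum.inl (Sum.inl s'))
      (fun y => Sum.map (fun z => Sum.inr (G.entry z)) id (κ y)) (F.next s o).1, (F.next s o).2))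
    (fun s o => (Sum.map Sum.inr id (G.next s o).1, (G.next s o).2))

section chain
variable {F : TokenProgram τ X Y} {κ : Y → Z ⊕ W} {G : TokenProgram τ Z W}

theorem reach_chain_right {q : G.State ⊕ W} {p p' : τ → ℕ} {w : W} (h : G.Reach q p w p') :
    (F.chain κ G).Reach (Sum.map Sum.inr id q) p w p' := by
  induction h with
  | exit y p => exact Reach.exit _ _
  | visit s p y p' _ ih => exact Reach.visit (F := F.chain κ G) (Sum.inr s) p y p' ih

theorem reach_chain_left {q : F.State ⊕ Y} {p p' p'' : τ → ℕ} {y : Y} {w : W}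
    (h : F.Reach q p y p')
    (hw : (F.chain κ G).Reach (Sum.map (fun z => Sum.inr (G.entry z)) id (κ y)) p' w p'') :
    (F.chain κ G).Reach (Sum.elim (fun s' => Sum.inl (Sum.inl s'))
      (fun y => Sum.map (fun z => Sum.inr (G.entry z)) id (κ y)) q) p w p'' := by
  induction h with
  | exit y p => exact hw
  | visit s p y p' _ ih => exact Reach.visit (F := F.chain κ G) (Sum.inl s) p w p'' (ih hw)

theorem exec_chain {x : X} {y : Y} {z : Z} {w : W} {p p' p'' : τ → ℕ} (hF : F.Exec x p y p')
    (hκ : κ y = Sum.inl z) (hG : G.Exec z p' w p'') : (F.chain κ G).Exec x p w p'' :=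
  reach_chain_left hF (by rw [hκ]; exact reach_chain_right hG)

theorem exec_chain_of_exit {x : X} {y : Y} {w : W} {p p' : τ → ℕ} (hF : F.Exec x p y p')
    (hκ : κ y = Sum.inr w) : (F.chain κ G).Exec x p w p' :=
  reach_chain_left hF (by rw [hκ]; exact Reach.exit _ _)

end chain

/-- Sequential composition. -/
def seq (F : TokenProgram τ X Y) (G : TokenProgram τ Y Z) : TokenProgram τ X Z :=
  F.chain Sum.inl G

theorem exec_seq {F : TokenProgram τ X Y} {G : TokenProgram τ Y Z} {x : X} {y : Y} {z : Z}
    {p p' p'' : τ → ℕ} (hF : F.Exec x p y p') (hG : G.Exec y p' z p'') :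
    (F.seq G).Exec x p z p'' :=
  exec_chain hF rfl hG

/-- Iteration: the exit values of `F` in `X` are fed back. -/
def loop (F : TokenProgram τ X (X ⊕ Y)) : TokenProgram τ X Y where
  State := F.State
  finite_state := F.finite_state
  entry := F.entry
  target := F.target
  next s o := (Sum.elim Sum.inl (Sum.map F.entry id) (F.next s o).1, (F.next s o).2)

section loop
variable {F : TokenProgram τ X (X ⊕ Y)}

theorem reach_loop {q : F.State ⊕ (X ⊕ Y)} {p p' p'' : τ → ℕ} {r : X ⊕ Y} {y : Y}
    (h : F.Reach q p r p') (hy : F.loop.Reach (Sum.map F.entry id r) p' y p'') :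
    F.loop.Reach (Sum.elim Sum.inl (Sum.map F.entry id) q) p y p'' := by
  induction h with
  | exit r p => exact hy
  | visit s p r p' _ ih => exact Reach.visit (F := F.loop) s p y p'' (ih hy)

theorem exec_loop_again {x x' : X} {y : Y} {p p' p'' : τ → ℕ}
    (h : F.Exec x p (Sum.inl x') p') (hy : F.loop.Exec x' p' y p'') : F.loop.Exec x p y p'' :=
  reach_loop h hy

theorem exec_loop_exit {x : X} {y : Y} {p p' : τ → ℕ} (h : F.Exec x p (Sum.inr y) p') :
    F.loop.Exec x p y p' :=
  reach_loop h (Reach.exit _ _)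

end loop

/-- Perform `F a` for all `a` in a list and then `G`. -/
def sweep {α : Type} (F : α → TokenProgram τ X X) (G : TokenProgram τ X Y) (l : List α) :
    TokenProgram τ X Y :=
  l.foldr (fun a H => (F a).seq H) G

/-- The set in the invariant `I` consists of the elements already treated; those outside the list
count as treated from the start. Keeping `G` as an arbitrary continuation allows sweeps to be
nested. -/
theorem exec_sweep {α : Type} {F : α → TokenProgram τ X X} {G : TokenProgram τ X Y}
    (I : Set α → X → (τ → ℕ) → Prop)
    (hF : ∀ a S x p, a ∉ S → I S x p → ∃ x' p', (F a).Exec x p x' p' ∧ I (insert a S) x' p')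
    {l : List α} (hl : l.Nodup) {x : X} {p : τ → ℕ} (hI : I {a | a ∉ l} x p) :
    ∃ x' p', I Set.univ x' p' ∧
      ∀ y p'', G.Exec x' p' y p'' → (sweep F G l).Exec x p y p'' := by
  induction l generalizing x p with
  | nil => exact ⟨x, p, by simpa using hI, fun y p'' h => h⟩
  | cons a l ih =>
    obtain ⟨ha, hl⟩ := List.nodup_cons.1 hl
    obtain ⟨x₁, p₁, h₁, hI₁⟩ := hF a _ x p (by simp) hI
    have hS : insert a {b | b ∉ a :: l} = {b | b ∉ l} := by
      ext b
      by_cases hb : b = a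
      · simp [hb, ha]
      · simp [hb]
    rw [hS] at hI₁
    obtain ⟨x₂, p₂, hI₂, h₂⟩ := ih hl hI₁
    exact ⟨x₂, p₂, hI₂, fun y p'' h => exec_seq h₁ (h₂ y p'' h)⟩

/-- A duplicate-free list of all elements of a finite type. -/
noncomputable def enumeration (α : Type) [Finite α] : List α :=
  (@Finset.univ α (Fintype.ofFinite α)).toList

theorem nodup_enumeration (α : Type) [Finite α] : (enumeration α).Nodup :=
  Finset.nodup_toList _

theorem mem_enumeration {α : Type} [Finite α] (a : α) : a ∈ enumeration α := by
  simp [enumeration]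

theorem exec_sweep_enumeration {α : Type} [Finite α] {F : α → TokenProgram τ X X}
    {G : TokenProgram τ X Y} (I : Set α → X → (τ → ℕ) → Prop)
    (hF : ∀ a S x p, a ∉ S → I S x p → ∃ x' p', (F a).Exec x p x' p' ∧ I (insert a S) x' p')
    {x : X} {p : τ → ℕ} (hI : I ∅ x p) :
    ∃ x' p', I Set.univ x' p' ∧
      ∀ y p'', G.Exec x' p' y p'' → (sweep F G (enumeration α)).Exec x p y p'' := by
  refine exec_sweep I hF (nodup_enumeration α) ?_
  convert hI
  ext a
  simp [mem_enumeration]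

/-- Visit some token and leave everything in place, while updating the data. -/
noncomputable def idle [Nonempty τ] [Finite X] (f : X → Y) : TokenProgram τ X Y :=
  visitOnce (fun _ => Classical.arbitrary τ) (fun x _ => (f x, Output.stay))

theorem exec_idle [Nonempty τ] [Finite X] (f : X → Y) (x : X) (p : τ → ℕ) :
    (idle f).Exec x p (f x) p := by
  have := exec_visitOnce (fun _ => Classical.arbitrary τ) (fun x _ => (f x, Output.stay)) x p
  rwa [moveToken_stay] at this

/-! ### Copying positions of tokens -/

/-- Bring token `t` to the root. -/
def reset (t : τ) : TokenProgram τ Unit Unit :=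
  (visitOnce (fun _ => t) (fun _ o => match o.1 with
    | NodeDegree.one => (Sum.inr (), Output.stay)
    | NodeDegree.two => (Sum.inl (), Output.port1))).loop

/-- Describing `p'` by its values keeps it fixed while `p` varies in the induction on the distance
to the root. -/
theorem exec_reset (t : τ) {p p' : τ → ℕ} (h0 : p' t = 0) (h : ∀ u, u ≠ t → p' u = p u) :
    (reset t).Exec () p () p' := by
  obtain ⟨n, hn⟩ : ∃ n, p t = n := ⟨_, rfl⟩
  induction n generalizing p with
  | zero =>
    have hp : p' = moveToken p t Output.stay := by
      rw [moveToken_stay]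
      ext u
      by_cases hu : u = t
      · simp [hu, hn, h0]
      · simp [h u hu]
    rw [hp]
    exact exec_loop_exit (exec_visitOnce_of_eq (t := fun _ => t) (by
      simp [observe, hn, nodeDegree]))
  | succ n ih =>
    refine exec_loop_again (x' := ()) (exec_visitOnce_of_eq (t := fun _ => t)
      (o := Output.port1) (by simp [observe, hn, nodeDegree])) (ih ?_ ?_)
    · intro u hu
      rw [h u hu, moveToken_of_ne _ _ _ hu]
    · simp [destination, hn]

open Classical in
/-- Move token `t` away from the root until it meets token `u`. -/
noncomputable def climb (t u : τ) : TokenProgram τ Unit Unit :=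
  (visitOnce (fun _ => t) (fun _ o => if u ∈ o.2 then (Sum.inr (), Output.stay)
    else (Sum.inl (), Output.port0))).loop

/-- A token that starts beyond `u` would never meet it, so `p t ≤ p u` is required; `assign` ensures
this by a reset. The induction is on the remaining distance. -/
theorem exec_climb {t u : τ} {p p' : τ → ℕ} (hle : p t ≤ p u) (ht : p' t = p u)
    (h : ∀ v, v ≠ t → p' v = p v) (htu : u ≠ t) : (climb t u).Exec () p () p' := by
  obtain ⟨n, hn⟩ := Nat.exists_eq_add_of_le hle
  induction n generalizing p with
  | zero =>
    have hp : p' = moveToken p t Output.stay := by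
      rw [moveToken_stay]
      ext v
      by_cases hv : v = t
      · simp [hv, hn, ht]
      · simp [h v hv]
    rw [hp]
    exact exec_loop_exit (exec_visitOnce_of_eq (t := fun _ => t) (by simp [observe, hn]))
  | succ n ih =>
    have hu := moveToken_of_ne p t Output.port0 htu
    refine exec_loop_again (x' := ()) (exec_visitOnce_of_eq (t := fun _ => t)
      (o := Output.port0) (by simp [observe, hn])) (ih ?_ ?_ ?_ ?_)
    · simp [destination, hu]
      omega
    · rw [hu, ht]
    · intro v hv
      rw [h v hv, moveToken_of_ne _ _ _ hv]
    · simp [destination, hu]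
      omega

/-- Place token `t` at the node of token `u`. -/
noncomputable def assign (t u : τ) : TokenProgram τ Unit Unit :=
  (reset t).seq (climb t u)

theorem exec_assign {t u : τ} {p p' : τ → ℕ} (ht : p' t = p u) (h : ∀ v, v ≠ t → p' v = p v)
    (htu : u ≠ t) : (assign t u).Exec () p () p' := by
  classical
  have hu : Function.update p t 0 u = p u := by simp [htu]
  refine exec_seq (p' := Function.update p t 0) (exec_reset t (by simp) ?_)
    (exec_climb (by simp) (by rw [ht, hu]) ?_ htu)
  · intro v hv
    simp [hv]
  · intro v hv
    simp [hv, h v hv]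

/-- Place the tokens `e a` at the nodes of the tokens `src a`. -/
noncomputable def assignAll [Nonempty τ] {α : Type} [Finite α] (e src : α → τ) :
    TokenProgram τ Unit Unit :=
  sweep (fun a => assign (e a) (src a)) (idle id) (enumeration α)

/-- No source is a target, so no copy overwrites a position that is still to be read. -/
theorem exec_assignAll [Nonempty τ] {α : Type} [Finite α] {e src : α → τ}
    (he : Function.Injective e) (hs : ∀ a, src a ∉ Set.range e) (p : τ → ℕ) :
    ∃ p', (assignAll e src).Exec () p () p' ∧ (∀ a, p' (e a) = p (src a)) ∧
      ∀ t, t ∉ Set.range e → p' t = p t := by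
  classical
  obtain ⟨_, p', ⟨h₁, h₂⟩, h⟩ := exec_sweep_enumeration
    (F := fun a => assign (e a) (src a)) (G := idle id) (x := ()) (p := p)
    (fun S _ q => (∀ a ∈ S, q (e a) = p (src a)) ∧ ∀ t, t ∉ Set.range e → q t = p t)
    (fun a S _ q ha hI => by
      refine ⟨(), Function.update q (e a) (q (src a)), exec_assign (by simp) ?_ ?_, ?_, ?_⟩
      · intro v hv
        simp [hv]
      · intro h'
        exact hs a ⟨a, h'.symm⟩
      · rintro b (rfl | hb)
        · simp [hI.2 _ (hs b)]
        · have : e b ≠ e a := fun h' => ha (he h' ▸ hb)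
          simp [this, hI.1 b hb]
      · intro t ht
        have : t ≠ e a := fun h' => ht ⟨a, h'.symm⟩
        simp [this, hI.2 t ht])
    ⟨by simp, fun _ _ => rfl⟩
  exact ⟨p', h _ _ (exec_idle id () p'), fun a => h₁ a trivial, h₂⟩

end TokenProgram

/-! ### The team that executes a token program -/

/-- A type for the tokens and the controller of the team that executes a token program. -/
inductive ControlState (τ S : Type) : Type
  | halt
  | walk (t : τ)
  | rest (t : τ)
  | wait
  | back (q : S ⊕ Unit)
  | go (q : S ⊕ Unit)

instance {τ S : Type} [Finite τ] [Finite S] : Finite (ControlState τ S) := by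
  refine Finite.of_injective
    (β := Option (Option ((τ ⊕ τ) ⊕ ((S ⊕ Unit) ⊕ (S ⊕ Unit))))) (fun
      | .halt => none
      | .wait => some none
      | .walk t => some (some (Sum.inl (Sum.inl t)))
      | .rest t => some (some (Sum.inl (Sum.inr t)))
      | .back q => some (some (Sum.inr (Sum.inl q)))
      | .go q => some (some (Sum.inr (Sum.inr q)))) ?_
  intro a b h
  cases a <;> cases b <;> simp_all

namespace TokenProgram

open ControlState

variable {τ : Type} (F : TokenProgram τ Unit Unit) (K : Set τ)

open Classical in
/-- The behaviour of the team that executes `F`. Tokens outside `K` walk to the root first, and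
the controller waits there for them. Afterwards the controller walks from the root to the token
to be visited; both know then what is to be done, and the controller returns to the root. When
`F` has exited, all tokens that meet the controller halt, and so does the controller. -/
noncomputable def behaviour : ControlState τ F.State → NodeDegree × Set (ControlState τ F.State) →
    ControlState τ F.State × Output
  | halt, _ => (halt, Output.stay)
  | walk t, (NodeDegree.one, _) => (rest t, Output.stay)
  | walk t, (NodeDegree.two, _) => (walk t, Output.port1)
  | rest t, (d, A) =>
    if go (Sum.inr ()) ∈ A then (halt, Output.stay)
    else if h : ∃ s, go (Sum.inl s) ∈ A ∧ F.target s = t then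
      (rest t, (F.next h.choose (d, {u | u = t ∨ rest u ∈ A})).2)
    else (rest t, Output.stay)
  | wait, (d, A) =>
    if d = NodeDegree.one ∧ ∀ t ∉ K, rest t ∈ A then (go (Sum.inl (F.entry ())), Output.stay)
    else (wait, Output.port1)
  | back q, (NodeDegree.one, _) => (go q, Output.stay)
  | back q, (NodeDegree.two, _) => (back q, Output.port1)
  | go (Sum.inl s), (d, A) =>
    if rest (F.target s) ∈ A then (back (F.next s (d, {u | rest u ∈ A})).1, Output.stay)
    else (go (Sum.inl s), Output.port0)
  | go (Sum.inr _), (_, A) =>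
    if ∃ t, rest t ∈ A then (halt, Output.stay) else (go (Sum.inr ()), Output.port0)

open Classical in
/-- The team that executes `F`. The agents are the tokens and the controller `none`. -/
noncomputable def toTeam [Finite τ] : Team where
  Agent := Option τ
  State := ControlState τ F.State
  finite_agent := inferInstance
  finite_state := by
    have := F.finite_state
    infer_instance
  halt := halt
  start
    | none => wait
    | some t => if t ∈ K then rest t else walk t
  start_injective := by
    intro a b h
    cases a <;> cases b <;> grind
  start_ne_halt a := by
    cases a <;> grind
  transition S I := (F.behaviour K S I).1
  output S I := (F.behaviour K S I).2

theorem behaviour_rest_of_forall_notMem {t : τ} {d : NodeDegree}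
    {A : Set (ControlState τ F.State)} (h : ∀ q, go q ∉ A) :
    F.behaviour K (rest t) (d, A) = (rest t, Output.stay) := by
  simp [behaviour, h]

/-- The token recovers the control state by choice among those it perceives. There is only one
controller, so the choice is forced to be `s`. -/
theorem behaviour_rest_of_target {s : F.State} {d : NodeDegree}
    {A : Set (ControlState τ F.State)} (h : ∀ q, go q ∈ A ↔ q = Sum.inl s) :
    F.behaviour K (rest (F.target s)) (d, A) =
      (rest (F.target s), (F.next s (d, {u | u = F.target s ∨ rest u ∈ A})).2) := by
  have hex : ∃ s', go (Sum.inl s') ∈ A ∧ F.target s' = F.target s := ⟨s, by simp [h], rfl⟩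
  have hs : hex.choose = s := by simpa [h] using hex.choose_spec.1
  have hn : go (Sum.inr ()) ∉ A := by simp [h]
  simp only [behaviour, hn, if_false, dif_pos hex]
  rw [hs]

variable [Finite τ]

theorem _root_.Team.CanBe.of_closed {A : Team} {a : A.Agent} (C : A.State → Prop)
    (h₀ : C (A.start a)) (h₁ : ∀ S I, C S → S ≠ A.halt → C (A.transition S I)) {S : A.State}
    (h : A.CanBe a S) : C S := by
  induction h with
  | start => exact h₀
  | next S I _ hS ih => exact h₁ S I ih hS

theorem canBe_none {S : ControlState τ F.State} (h : (F.toTeam K).CanBe none S) :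
    S = halt ∨ S = wait ∨ (∃ q, S = back q) ∨ ∃ q, S = go q := by
  refine h.of_closed (fun S : ControlState τ F.State =>
    S = halt ∨ S = wait ∨ (∃ q, S = back q) ∨ ∃ q, S = go q) (by simp [toTeam]) ?_
  · intro S I ih hS
    change (F.behaviour K S I).1 = _ ∨ (F.behaviour K S I).1 = _ ∨
      (∃ q, (F.behaviour K S I).1 = _) ∨ ∃ q, (F.behaviour K S I).1 = _
    obtain ⟨d, A⟩ := I
    rcases ih with rfl | rfl | ⟨q, rfl⟩ | ⟨q, rfl⟩
    · exact absurd rfl hS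
    · simp only [behaviour]; split_ifs <;> simp
    · cases d <;> simp [behaviour]
    · cases q
      · simp only [behaviour]; split_ifs <;> simp
      · simp only [behaviour]; split_ifs <;> simp

theorem canBe_some {t : τ} {S : ControlState τ F.State} (h : (F.toTeam K).CanBe (some t) S) :
    S = halt ∨ S = walk t ∨ S = rest t := by
  refine h.of_closed (fun S : ControlState τ F.State => S = halt ∨ S = walk t ∨ S = rest t)
    (by by_cases ht : t ∈ K <;> simp [toTeam, ht]) ?_
  · intro S I ih hS
    change (F.behaviour K S I).1 = _ ∨ (F.behaviour K S I).1 = _ ∨ (F.behaviour K S I).1 = _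
    obtain ⟨d, A⟩ := I
    rcases ih with rfl | rfl | rfl
    · exact absurd rfl hS
    · cases d <;> simp [behaviour]
    · simp only [behaviour]; split_ifs <;> simp

/-- A token that has not stopped carries its own name in its state, and the controller uses other
constructors. -/
theorem disjointSlices_toTeam : (F.toTeam K).DisjointSlices := by
  intro a b hab
  rw [Set.disjoint_left]
  rintro S ⟨ha, hS⟩ ⟨hb, -⟩
  change S ≠ halt at hS
  cases a with
  | none =>
    cases b with
    | none => exact hab rfl
    | some u =>
      rcases F.canBe_none K ha with h | h
      · exact hS h
      · rcases h with rfl | ⟨q, rfl⟩ | ⟨q, rfl⟩ <;> simpa using F.canBe_some K hb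
  | some t =>
    cases b with
    | none =>
      rcases F.canBe_none K hb with h | h
      · exact hS h
      · rcases h with rfl | ⟨q, rfl⟩ | ⟨q, rfl⟩ <;> simpa using F.canBe_some K ha
    | some u =>
      have htu : t ≠ u := fun h => hab (by rw [h])
      rcases F.canBe_some K ha with rfl | rfl | rfl
      · exact hS rfl
      · simpa [htu] using F.canBe_some K hb
      · simpa [htu] using F.canBe_some K hb

theorem config_ext {A : Team} {c d : A.Config} (h : ∀ a, c.pos a = d.pos a)
    (h' : ∀ a, c.state a = d.state a) : c = d := by
  cases c
  cases d
  simp only [Team.Config.mk.injEq]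
  exact ⟨funext h, funext h'⟩

/-- The configuration with the tokens placed by `p` and the controller at node `v`. -/
def config (p : τ → ℕ) (f : τ → ControlState τ F.State) (v : ℕ) (S : ControlState τ F.State) :
    (F.toTeam K).Config where
  pos | none => v
      | some t => p t
  state | none => S
        | some t => f t

section config
variable (p : τ → ℕ) (f : τ → ControlState τ F.State) (v : ℕ) (S : ControlState τ F.State)

theorem input_none : (F.toTeam K).input (F.config K p f v S) none =
    (nodeDegree v, {R | ∃ t, p t = v ∧ f t = R}) := by
  refine Prod.ext rfl (Set.ext fun R => ⟨?_, ?_⟩)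
  · rintro ⟨b, hb, hpos, hst⟩
    cases b with
    | none => exact absurd rfl hb
    | some t => exact ⟨t, hpos, hst⟩
  · rintro ⟨t, hpos, hst⟩
    exact ⟨some t, Option.some_ne_none t, hpos, hst⟩

theorem input_some (t : τ) : (F.toTeam K).input (F.config K p f v S) (some t) =
    (nodeDegree (p t), {R | (v = p t ∧ S = R) ∨ ∃ u, u ≠ t ∧ p u = p t ∧ f u = R}) := by
  refine Prod.ext rfl (Set.ext fun R => ⟨?_, ?_⟩)
  · rintro ⟨b, hb, hpos, hst⟩
    cases b with
    | none => exact Or.inl ⟨hpos, hst⟩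
    | some u => exact Or.inr ⟨u, fun h => hb (by rw [h]), hpos, hst⟩
  · rintro (⟨hpos, hst⟩ | ⟨u, hu, hpos, hst⟩)
    · exact ⟨none, (Option.some_ne_none t).symm, hpos, hst⟩
    · exact ⟨some u, fun h => hu (Option.some.inj h), hpos, hst⟩

theorem step_config {p' : τ → ℕ} {f' : τ → ControlState τ F.State} {v' : ℕ}
    {S' : ControlState τ F.State} {o : Output}
    (hS : F.behaviour K S (nodeDegree v, {R | ∃ t, p t = v ∧ f t = R}) = (S', o))
    (hv : destination v o = v')
    (hf : ∀ t, ∃ o', F.behaviour K (f t) (nodeDegree (p t),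
      {R | (v = p t ∧ S = R) ∨ ∃ u, u ≠ t ∧ p u = p t ∧ f u = R}) = (f' t, o') ∧
      destination (p t) o' = p' t) :
    (F.toTeam K).step (F.config K p f v S) = F.config K p' f' v' S' := by
  -- On `halt`, `behaviour` already prescribes `(halt, stay)`, so stopped agents need no separate
  -- treatment afterwards.
  have key : ∀ (R R' : ControlState τ F.State) (I : NodeDegree × Set (ControlState τ F.State))
      (o : Output) (w w' : ℕ), F.behaviour K R I = (R', o) → destination w o = w' →
      (open Classical in (if R = halt then w else destination w (F.behaviour K R I).2)) = w' ∧
      (open Classical in (if R = halt then halt else (F.behaviour K R I).1)) = R' := by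
    intro R R' I o w w' h hw
    by_cases hR : R = halt
    · subst hR
      simp only [behaviour, Prod.mk.injEq] at h
      obtain ⟨rfl, rfl⟩ := h
      simpa [destination] using hw
    · simp [hR, h, hw]
  refine config_ext ?_ ?_
  · rintro (_ | t)
    · rw [← F.input_none K] at hS
      exact (key _ _ _ _ _ _ hS hv).1
    · obtain ⟨o', h₁, h₂⟩ := hf t
      rw [← F.input_some K] at h₁
      exact (key _ _ _ _ _ _ h₁ h₂).1
  · rintro (_ | t)
    · rw [← F.input_none K] at hS
      exact (key _ _ _ _ _ _ hS hv).2
    · obtain ⟨o', h₁, h₂⟩ := hf t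
      rw [← F.input_some K] at h₁
      exact (key _ _ _ _ _ _ h₁ h₂).2

end config

section work
variable (p : τ → ℕ) (v : ℕ)

/-- Resting tokens react to `go` only, so a returning controller leaves them undisturbed. -/
theorem step_back_zero (q : F.State ⊕ Unit) :
    (F.toTeam K).step (F.config K p rest 0 (back q)) = F.config K p rest 0 (go q) :=
  F.step_config K p rest 0 (back q) (o := Output.stay) rfl rfl
    fun t => ⟨Output.stay, by simp [behaviour], rfl⟩

theorem step_back_succ (q : F.State ⊕ Unit) :
    (F.toTeam K).step (F.config K p rest (v + 1) (back q)) = F.config K p rest v (back q) :=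
  F.step_config K p rest (v + 1) (back q) (o := Output.port1) rfl rfl
    fun t => ⟨Output.stay, by simp [behaviour], rfl⟩

theorem step_go_of_ne (s : F.State) (h : p (F.target s) ≠ v) :
    (F.toTeam K).step (F.config K p rest v (go (Sum.inl s))) =
      F.config K p rest (v + 1) (go (Sum.inl s)) := by
  refine F.step_config K p rest v _ (o := Output.port0) (by simp [behaviour, h]) rfl
    fun t => ⟨Output.stay, ?_, rfl⟩
  have : ¬ ∃ s', (v = p t ∧ s = s') ∧ F.target s' = t := by
    rintro ⟨_, ⟨rfl, rfl⟩, rfl⟩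
    exact h rfl
  simp [behaviour]
  grind

/-- Controller and token apply `F.next s` to the same observation; the one takes the new control
state, the other the move. The controller leaves `go` in this very round, so the move is made only
once. -/
theorem step_go_target (s : F.State) :
    (F.toTeam K).step (F.config K p rest (p (F.target s)) (go (Sum.inl s))) =
      F.config K (moveToken p (F.target s) (F.next s (observe p (F.target s))).2) rest
        (p (F.target s)) (back (F.next s (observe p (F.target s))).1) := by
  refine F.step_config K p rest _ _ (o := Output.stay) (by simp [behaviour, observe]) rfl
    fun t => ?_
  by_cases ht : F.target s = t
  · subst ht
    refine ⟨(F.next s (observe p (F.target s))).2, ?_, by simp⟩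
    rw [F.behaviour_rest_of_target K (s := s) (fun q => by simp [eq_comm])]
    -- A token perceives only the others; adding itself gives the set seen by the controller.
    congr 4
    ext u
    by_cases hu : u = F.target s <;> simp [hu]
  · refine ⟨Output.stay, ?_, ?_⟩
    · simp [behaviour]
      grind
    · rw [moveToken_of_ne _ _ _ (Ne.symm ht)]; rfl

theorem step_finish_of_ne (h : ∀ t, p t ≠ v) :
    (F.toTeam K).step (F.config K p rest v (go (Sum.inr ()))) =
      F.config K p rest (v + 1) (go (Sum.inr ())) := by
  refine F.step_config K p rest v _ (o := Output.port0) (by simp [behaviour, h]) rfl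
    fun t => ⟨Output.stay, ?_, rfl⟩
  simp [behaviour, (h t).symm]

theorem step_finish [Nonempty τ] :
    (F.toTeam K).step (F.config K (fun _ => v) rest v (go (Sum.inr ()))) =
      F.config K (fun _ => v) (fun _ => halt) v halt :=
  F.step_config K _ rest v _ (o := Output.stay) (by simp [behaviour]) rfl
    fun t => ⟨Output.stay, by simp [behaviour], rfl⟩

end work

theorem iterate_back (p : τ → ℕ) (q : F.State ⊕ Unit) (v : ℕ) :
    ∃ n, (F.toTeam K).step^[n] (F.config K p rest v (back q)) = F.config K p rest 0 (go q) := by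
  induction v with
  | zero => exact ⟨1, F.step_back_zero K p q⟩
  | succ v ih =>
    obtain ⟨n, hn⟩ := ih
    exact ⟨n + 1, by rw [Function.iterate_succ_apply, step_back_succ, hn]⟩

theorem iterate_go (p : τ → ℕ) (s : F.State) (v : ℕ) (hv : v ≤ p (F.target s)) :
    (F.toTeam K).step^[v] (F.config K p rest 0 (go (Sum.inl s))) =
      F.config K p rest v (go (Sum.inl s)) := by
  induction v with
  | zero => rfl
  | succ v ih =>
    rw [Function.iterate_succ_apply', ih (by omega), step_go_of_ne _ _ _ _ _ (by omega)]

theorem iterate_finish [Nonempty τ] (w v : ℕ) (hv : v ≤ w) :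
    (F.toTeam K).step^[v] (F.config K (fun _ => w) rest 0 (go (Sum.inr ()))) =
      F.config K (fun _ => w) rest v (go (Sum.inr ())) := by
  induction v with
  | zero => rfl
  | succ v ih =>
    rw [Function.iterate_succ_apply', ih (by omega),
      step_finish_of_ne _ _ _ _ (fun _ => by omega)]

/-- Each visit costs the way out, one round at the token and the way back, so consecutive control
states correspond to root visits of the controller. -/
theorem iterate_reach {q : F.State ⊕ Unit} {p p' : τ → ℕ} {y : Unit} (h : F.Reach q p y p') :
    ∃ n, (F.toTeam K).step^[n] (F.config K p rest 0 (go q)) =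
      F.config K p' rest 0 (go (Sum.inr ())) := by
  induction h with
  | exit y p => exact ⟨0, rfl⟩
  | visit s p y p' _ ih =>
    obtain ⟨n, hn⟩ := ih
    obtain ⟨m, hm⟩ := F.iterate_back K
      (moveToken p (F.target s) (F.next s (observe p (F.target s))).2)
      (F.next s (observe p (F.target s))).1 (p (F.target s))
    refine ⟨n + (m + (1 + p (F.target s))), ?_⟩
    rw [Function.iterate_add_apply, Function.iterate_add_apply, Function.iterate_add_apply,
      F.iterate_go K p s _ le_rfl, Function.iterate_one, F.step_go_target K, hm, hn]

theorem run_eq_iterate (A : Team) (loc : A.Agent → ℕ) (t : ℕ) :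
    A.run loc t = A.step^[t] (A.run loc 0) := by
  induction t with
  | zero => rfl
  | succ t ih => rw [Function.iterate_succ_apply', ← ih]; rfl

/-! ### Gathering at the root, and the resulting synchronized computation -/

open Classical in
/-- The configuration after `t` rounds during which the controller has waited. -/
theorem run_wait {n : ℕ} (grp : Option τ → Fin n) (m : Fin n → τ)
    (hm : ∀ i, m i ∉ K ∧ grp (some (m i)) = i) (x : Fin n → ℕ) (t : ℕ)
    (ht : ∀ t' < t, ∃ i, t' ≤ x i) :
    (F.toTeam K).run (fun a => x (grp a)) t =
      F.config K (fun u => if u ∈ K then x (grp (some u)) else x (grp (some u)) - t)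
        (fun u => if u ∈ K ∨ x (grp (some u)) < t then rest u else walk u)
        (x (grp none) - t) wait := by
  induction t with
  | zero =>
    refine config_ext ?_ ?_
    · rintro (_ | u) <;> simp [Team.run, config]
    · rintro (_ | u)
      · rfl
      · simp [Team.run, config, toTeam]
  | succ t ih =>
    obtain ⟨i, hi⟩ := ht t (by omega)
    change (F.toTeam K).step _ = _
    rw [ih fun t' h' => ht t' (by omega)]
    refine F.step_config K _ _ _ _ (o := Output.port1) ?_ (by simp [destination]; omega) ?_
    -- Since `t ≤ x i`, the synchronizer `m i` is still in state `walk`, which keeps the controller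
    -- waiting.
    · have : ¬ ∀ u ∉ K, ∃ u', (if u' ∈ K then x (grp (some u')) else x (grp (some u')) - t) =
          x (grp none) - t ∧
          (if u' ∈ K ∨ x (grp (some u')) < t then rest u' else walk u') =
            (rest u : ControlState τ F.State) := by
        intro h
        obtain ⟨u', -, h⟩ := h (m i) (hm i).1
        split_ifs at h with h'
        obtain rfl : u' = m i := by simpa using h
        rw [(hm i).2] at h'
        rcases h' with h' | h'
        · exact (hm i).1 h'
        · omega
      simp only [behaviour, Set.mem_ofPred_eq, this, and_false, if_false]
    · have hgo (u : τ) (w : ℕ) (q : F.State ⊕ Unit) : go q ∉ {R : ControlState τ F.State |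
          (x (grp none) - t = w ∧ wait = R) ∨
          ∃ u', u' ≠ u ∧ (if u' ∈ K then x (grp (some u')) else x (grp (some u')) - t) = w ∧
            (if u' ∈ K ∨ x (grp (some u')) < t then rest u' else walk u') = R} := by
        rintro (⟨-, h⟩ | ⟨u', -, -, h⟩)
        · simp at h
        · split_ifs at h
      intro u
      by_cases hu : u ∈ K
      · refine ⟨Output.stay, ?_, by simp [hu, destination]⟩
        simp only [hu, true_or, if_true]
        exact F.behaviour_rest_of_forall_notMem K (hgo _ _)
      -- A walking token from node `x` is at the root in round `x` but enters `rest` only in the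
      -- next round; hence the strict inequality.
      · by_cases hx : x (grp (some u)) < t
        · refine ⟨Output.stay, ?_, by simp [hu, destination]; omega⟩
          have h1 : x (grp (some u)) < t + 1 := by omega
          simp only [hx, h1, or_true, if_true]
          exact F.behaviour_rest_of_forall_notMem K (hgo _ _)
        · by_cases hx' : x (grp (some u)) = t
          · refine ⟨Output.stay, ?_, by simp [hu, destination]; omega⟩
            simp [hu, hx', nodeDegree, behaviour]
          · obtain ⟨d, hd⟩ : ∃ d, x (grp (some u)) - t = d + 1 :=
              ⟨x (grp (some u)) - t - 1, by omega⟩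
            refine ⟨Output.port1, ?_, by simp [hu, destination]; omega⟩
            have h1 : ¬ x (grp (some u)) < t + 1 := by omega
            simp [hu, hx, h1, hd, nodeDegree, behaviour]

open Classical in
-- Once every token outside `K` rests at the root, the synchronizers are all there and the program
-- starts with its arguments intact. At its end all tokens are at `f x`, so the controller meets
-- them together and all agents stop in the same round.
theorem synchronizedComputes_toTeam [Nonempty τ] {n : ℕ} (grp : Option τ → Fin n)
    (m : Fin n → τ) (hm : ∀ i, m i ∉ K ∧ grp (some (m i)) = i) (f : (Fin n → ℕ) → ℕ)
    (hF : ∀ x : Fin n → ℕ,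
      F.Exec () (fun u => if u ∈ K then x (grp (some u)) else 0) () (fun _ => f x)) :
    (F.toTeam K).SynchronizedComputes f := by
  have gather (x : Fin n → ℕ) : ∃ t, (F.toTeam K).run (fun a => x (grp a)) t =
      F.config K (fun u => if u ∈ K then x (grp (some u)) else 0) rest 0 wait := by
    have hex : ∃ t, ∀ i, x i < t :=
      ⟨∑ i, x i + 1, fun i => Nat.lt_succ_of_le
        (Finset.single_le_sum (f := x) (fun _ _ => Nat.zero_le _) (Finset.mem_univ i))⟩
    -- The first round exceeding all arguments: before it some synchronizer is not yet resting.
    refine ⟨Nat.find hex, ?_⟩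
    rw [F.run_wait K grp m hm x _ fun t' ht' => by simpa using Nat.find_min hex ht']
    have hlt := Nat.find_spec hex
    have h0 i : x i - Nat.find hex = 0 := Nat.sub_eq_zero_of_le (hlt i).le
    simp [hlt, h0]
  refine ⟨grp, fun i => ⟨some (m i), (hm i).2⟩, fun x => ?_, fun i => some (m i),
    fun i => (hm i).2, fun x => ?_⟩
  · obtain ⟨t, ht⟩ := gather x
    have hstep : (F.toTeam K).step
        (F.config K (fun u => if u ∈ K then x (grp (some u)) else 0) rest 0 wait) =
        F.config K (fun u => if u ∈ K then x (grp (some u)) else 0) rest 0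
          (go (Sum.inl (F.entry ()))) := by
      refine F.step_config K _ _ _ _ (o := Output.stay) ?_ rfl
        fun u => ⟨Output.stay, F.behaviour_rest_of_forall_notMem K (by simp), rfl⟩
      have : ∀ u ∉ K, ∃ u', (if u' ∈ K then x (grp (some u')) else 0) = 0 ∧
          (rest u' : ControlState τ F.State) = rest u := fun u hu => ⟨u, by simp [hu], rfl⟩
      simp only [behaviour, nodeDegree, Set.mem_ofPred_eq, true_and]
      rw [if_pos this]
    obtain ⟨k, hk⟩ := F.iterate_reach K (hF x)
    refine ⟨(f x + 1) + (k + 1) + t, ?_⟩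
    have : (F.toTeam K).run (fun a => x (grp a)) ((f x + 1) + (k + 1) + t) =
        F.config K (fun _ => f x) (fun _ => halt) (f x) halt := by
      rw [run_eq_iterate, Function.iterate_add_apply, ← run_eq_iterate, ht,
        Function.iterate_add_apply, Function.iterate_succ_apply _ k, hstep, hk,
        Function.iterate_succ_apply' _ (f x), F.iterate_finish K _ _ le_rfl, F.step_finish K]
    rw [this]
    rintro (_ | u) <;> exact ⟨rfl, rfl⟩
  · obtain ⟨t, ht⟩ := gather x
    refine ⟨t, fun i => ?_⟩
    rw [ht]
    simp [config, (hm i).1]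

end TokenProgram

/-! ### Simulating a team by a token program -/

namespace TokenProgram

section simulation
variable {τ : Type} (A : Team) (e : A.Agent → τ)

open Classical in
/-- The next state and the move of agent `a`, computed from the states of all agents and from
what is observed at the token `e a`. -/
noncomputable def action (s : A.Agent → A.State) (a : A.Agent) (o : NodeDegree × Set τ) :
    A.State × Output :=
  if s a = A.halt then (A.halt, Output.stay)
  else (A.transition (s a) (o.1, {S | ∃ b, b ≠ a ∧ e b ∈ o.2 ∧ s b = S}),
    A.output (s a) (o.1, {S | ∃ b, b ≠ a ∧ e b ∈ o.2 ∧ s b = S}))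

variable {A e} in
-- When the tokens stand where the agents do, the tokens at a node and the remembered states
-- determine the agent's input.
theorem action_observe {c : A.Config} {p : τ → ℕ} (hp : ∀ a, p (e a) = c.pos a) (a : A.Agent) :
    (action A e c.state a (observe p (e a))).1 = (A.step c).state a ∧
      destination (c.pos a) (action A e c.state a (observe p (e a))).2 = (A.step c).pos a := by
  have hI : ((observe p (e a)).1, {S | ∃ b, b ≠ a ∧ e b ∈ (observe p (e a)).2 ∧ c.state b = S}) =
      A.input c a := by
    simp [observe, Team.input, hp]
  unfold action
  rw [hI]
  by_cases h : c.state a = A.halt <;> simp [h, Team.step, destination]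

/-- What the simulation of a team has to remember: the states of the agents and, within a round,
what the agents are going to do. -/
abbrev Memory (A : Team) : Type :=
  (A.Agent → A.State) × (A.Agent → A.State × Output)

instance : Finite Output := by
  refine Finite.of_injective (β := Option Bool) (fun
      | .stay => none
      | .port0 => some true
      | .port1 => some false) ?_
  intro a b h
  cases a <;> cases b <;> simp_all

theorem finite_memory : Finite (Memory A) := by
  have := A.finite_agent
  have := A.finite_state
  infer_instance

open Classical in
/-- Let the agents of a team observe their surroundings, one after the other. -/
noncomputable def look (a : A.Agent) : TokenProgram τ (Memory A) (Memory A) :=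
  have := finite_memory A
  visitOnce (fun _ => e a) fun x o =>
    ((x.1, Function.update x.2 a (action A e x.1 a o)), Output.stay)

/-- Let agent `a` move as it has decided to. -/
noncomputable def act (a : A.Agent) : TokenProgram τ (Memory A) (Memory A) :=
  have := finite_memory A
  visitOnce (fun _ => e a) fun x _ => (x, (x.2 a).2)

open Classical in
/-- Update the states of the agents. Exit if all agents have stopped. -/
noncomputable def finishRound [Nonempty τ] : TokenProgram τ (Memory A) (Memory A ⊕ Unit) :=
  have := finite_memory A
  idle fun x => if ∀ a, (x.2 a).1 = A.halt then Sum.inr ()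
    else Sum.inl (fun a => (x.2 a).1, x.2)

/-- One round of the computation of a team. -/
noncomputable def round [Nonempty τ] : TokenProgram τ (Memory A) (Memory A ⊕ Unit) :=
  have := A.finite_agent
  sweep (look A e) (sweep (act A e) (finishRound A) (enumeration A.Agent))
    (enumeration A.Agent)

open Classical in
-- All decisions are computed from the old placement and stored, so performing the moves one by one
-- has the effect of a simultaneous step.
theorem exec_round [Nonempty τ] (he : Function.Injective e) {c : A.Config} {p : τ → ℕ}
    (hp : ∀ a, p (e a) = c.pos a) (o : A.Agent → A.State × Output) :
    ∃ (o' : A.Agent → A.State × Output) (p' : τ → ℕ),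
      (round A e).Exec (c.state, o) p
        (if ∀ a, (A.step c).state a = A.halt then Sum.inr ()
          else Sum.inl ((A.step c).state, o')) p' ∧
      (∀ a, p' (e a) = (A.step c).pos a) ∧ ∀ t, t ∉ Set.range e → p' t = p t := by
  have := A.finite_agent
  have := finite_memory A
  obtain ⟨⟨s₁, o₁⟩, p₁, ⟨h₁, rfl, h₁'⟩, hrun₁⟩ := exec_sweep_enumeration
    (F := look A e) (G := sweep (act A e) (finishRound A) (enumeration A.Agent))
    (x := (c.state, o)) (p := p)
    (fun S x q => x.1 = c.state ∧ q = p ∧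
      ∀ a ∈ S, x.2 a = action A e c.state a (observe p (e a)))
    (fun a S x q _ hI => by
      obtain ⟨h₁, rfl, h₂⟩ := hI
      refine ⟨(x.1, Function.update x.2 a (action A e x.1 a (observe q (e a)))), q, ?_, h₁, rfl,
        ?_⟩
      · have := exec_visitOnce_of_eq (t := fun _ => e a) (f := fun (x : Memory A) o =>
          ((x.1, Function.update x.2 a (action A e x.1 a o)), Output.stay)) (x := x) (p := q) rfl
        rwa [moveToken_stay] at this
      · intro b hb
        by_cases hba : b = a
        · subst hba
          simp [h₁]
        · simp [hba, h₂ b (hb.resolve_left hba)])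
    ⟨rfl, rfl, by simp⟩
  obtain rfl : s₁ = c.state := h₁
  have ho a : o₁ a = action A e c.state a (observe p₁ (e a)) := h₁' a trivial
  -- The invariant also records that untreated agents are at their old nodes, from which their
  -- stored moves are to be made.
  obtain ⟨_, p₂, ⟨rfl, h₂, -, h₂'⟩, hrun₂⟩ := exec_sweep_enumeration
    (F := act A e) (G := finishRound A) (x := (c.state, o₁)) (p := p₁)
    (fun S x q => x = (c.state, o₁) ∧ (∀ a ∈ S, q (e a) = (A.step c).pos a) ∧
      (∀ a ∉ S, q (e a) = c.pos a) ∧ ∀ t, t ∉ Set.range e → q t = p₁ t)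
    (fun a S x q ha hI => by
      obtain ⟨rfl, h₁, h₂, h₃⟩ := hI
      have hne : ∀ b, b ≠ a → e b ≠ e a := fun b hb h => hb (he h)
      refine ⟨(c.state, o₁), moveToken q (e a) (o₁ a).2, exec_visitOnce_of_eq rfl, rfl, ?_, ?_, ?_⟩
      · intro b hb
        by_cases hba : b = a
        · subst hba
          rw [moveToken_self, h₂ b ha, ho b, (action_observe hp b).2]
        · rw [moveToken_of_ne _ _ _ (hne b hba), h₁ b (hb.resolve_left hba)]
      · intro b hb
        have hb := not_or.1 hb
        rw [moveToken_of_ne _ _ _ (hne b hb.1), h₂ b hb.2]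
      · intro t ht
        rw [moveToken_of_ne _ _ _ (fun h => ht ⟨a, h.symm⟩), h₃ t ht])
    ⟨rfl, by simp, fun a _ => hp a, fun _ _ => rfl⟩
  refine ⟨o₁, p₂, hrun₁ _ _ (hrun₂ _ _ ?_), fun a => h₂ a trivial, h₂'⟩
  have hst a : (o₁ a).1 = (A.step c).state a := by rw [ho a, (action_observe hp a).1]
  have := exec_idle (fun x : Memory A => if ∀ a, (x.2 a).1 = A.halt then Sum.inr ()
    else Sum.inl (fun a => (x.2 a).1, x.2)) (c.state, o₁) p₂
  simp only [hst] at this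
  exact this

theorem iterate_step_of_forall_halt {A : Team} {c : A.Config} (h : ∀ a, c.state a = A.halt)
    (n : ℕ) : A.step^[n] c = c := by
  have : A.step c = c := config_ext (by simp [Team.step, h]) (by simp [Team.step, h])
  exact Function.iterate_fixed this n

variable {A e} in
-- The exit test follows a round, hence `n + 1`. An earlier exit does no harm, because a
-- configuration with all agents stopped is a fixed point of `A.step`.
theorem exec_loop_round [Nonempty τ] (he : Function.Injective e) {v n : ℕ} {c : A.Config}
    {p : τ → ℕ} (hp : ∀ a, p (e a) = c.pos a) (o : A.Agent → A.State × Output)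
    (hc : ∀ a, (A.step^[n + 1] c).pos a = v ∧ (A.step^[n + 1] c).state a = A.halt) :
    ∃ p', (round A e).loop.Exec (c.state, o) p () p' ∧ (∀ a, p' (e a) = v) ∧
      ∀ t, t ∉ Set.range e → p' t = p t := by
  classical
  induction n generalizing c p o with
  | zero =>
    obtain ⟨o', p', h, h₁, h₂⟩ := exec_round A e he hp o
    rw [if_pos (show ∀ a, (A.step c).state a = A.halt from fun a => (hc a).2)] at h
    exact ⟨p', exec_loop_exit h, fun a => by rw [h₁]; exact (hc a).1, h₂⟩
  | succ n ih =>
    obtain ⟨o', p', h, h₁, h₂⟩ := exec_round A e he hp o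
    by_cases hh : ∀ a, (A.step c).state a = A.halt
    · rw [if_pos hh] at h
      refine ⟨p', exec_loop_exit h, fun a => ?_, h₂⟩
      have := (hc a).1
      rwa [Function.iterate_succ_apply, iterate_step_of_forall_halt hh, ← h₁] at this
    · rw [if_neg hh] at h
      obtain ⟨p'', h', h₃, h₄⟩ := ih h₁ o' hc
      exact ⟨p'', exec_loop_again h h', h₃, fun t ht => (h₄ t ht).trans (h₂ t ht)⟩

/-- Run a team on the arguments held by the tokens `src` and store the result in token `res`. -/
noncomputable def call [Nonempty τ] [Nonempty A.Agent] {n : ℕ} (grp : A.Agent → Fin n)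
    (src : Fin n → τ) (res : τ) : TokenProgram τ Unit Unit :=
  have := A.finite_agent
  (assignAll e (fun a => src (grp a))).seq
    ((idle fun _ => (A.start, fun _ => (A.halt, Output.stay))).seq
      ((round A e).loop.seq (assign res (e (Classical.arbitrary A.Agent)))))

/-- Only the tokens of the agents and `res` change, so calls can be repeated with the same
arguments. The token `res` may itself be a source, as it is written only at the end. -/
theorem exec_call [Nonempty τ] [Nonempty A.Agent] (he : Function.Injective e) {n : ℕ}
    {grp : A.Agent → Fin n} {f : (Fin n → ℕ) → ℕ} (hA : A.ComputesWith grp f)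
    {src : Fin n → τ} {res : τ} (hsrc : ∀ i, src i ∉ Set.range e) (hres : res ∉ Set.range e)
    (p : τ → ℕ) :
    ∃ p', (call A e grp src res).Exec () p () p' ∧ p' res = f (fun i => p (src i)) ∧
      ∀ t, t ∉ Set.range e → t ≠ res → p' t = p t := by
  classical
  have := A.finite_agent
  obtain ⟨p₁, h₁, h₁', h₁''⟩ := exec_assignAll (src := fun a => src (grp a)) he
    (fun a => hsrc (grp a)) p
  obtain ⟨T, hT⟩ := hA fun i => p (src i)
  -- A further round does not change a stopped configuration and gives the form `n + 1`.
  have hT' : ∀ a, (A.step^[T + 1] (A.run (fun b => p (src (grp b))) 0)).pos a =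
      f (fun i => p (src i)) ∧
      (A.step^[T + 1] (A.run (fun b => p (src (grp b))) 0)).state a = A.halt := by
    rw [Function.iterate_succ_apply', ← run_eq_iterate,
      ← Function.iterate_one A.step, iterate_step_of_forall_halt fun a => (hT a).2]
    exact hT
  obtain ⟨p₂, h₂, h₂', h₂''⟩ := exec_loop_round (c := A.run (fun b => p (src (grp b))) 0) he h₁'
    (fun _ => (A.halt, Output.stay)) hT'
  refine ⟨Function.update p₂ res (f fun i => p (src i)),
    exec_seq h₁ (exec_seq (exec_idle _ () p₁) (exec_seq h₂ (exec_assign ?_ ?_ ?_))), ?_, ?_⟩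
  · simp [h₂']
  · intro t ht
    simp [ht]
  · exact fun h => hres ⟨_, h⟩
  · simp
  · intro t ht ht'
    simp [ht', h₂'' t ht, h₁'' t ht]

end simulation

end TokenProgram

/-! ### Primitive recursion as a token program -/

/-- The tokens used for primitive recursion: the arguments, the synchronizers, the recursion
counter, the result, and the agents of the two given teams. -/
inductive RecursionToken (n : ℕ) (H G : Type) : Type
  | arg (i : Fin n)
  | sync (i : Fin n)
  | counter
  | result
  | base (a : H)
  | step (a : G)

namespace RecursionToken

variable {n : ℕ} {H G : Type}

instance [Finite H] [Finite G] : Finite (RecursionToken n H G) := by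
  refine Finite.of_injective (β := Option (Option ((Fin n ⊕ Fin n) ⊕ (H ⊕ G)))) (fun
      | .counter => none
      | .result => some none
      | .arg i => some (some (Sum.inl (Sum.inl i)))
      | .sync i => some (some (Sum.inl (Sum.inr i)))
      | .base a => some (some (Sum.inr (Sum.inl a)))
      | .step a => some (some (Sum.inr (Sum.inr a)))) ?_
  intro a b h
  cases a <;> cases b <;> simp_all

instance : Nonempty (RecursionToken n H G) := ⟨counter⟩

end RecursionToken

namespace TokenProgram

open RecursionToken

section recursion
variable {k : ℕ} {h : (Fin k → ℕ) → ℕ} {g : (Fin (k + 2) → ℕ) → ℕ} (Ah Ag : Team)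
  [Nonempty Ag.Agent] (grpH : Ah.Agent → Fin k)
  (grpG : Ag.Agent → Fin (k + 2))

/-- The tokens that hold the arguments of the iterated function. -/
def stepSource (k : ℕ) (H G : Type) : Fin (k + 2) → RecursionToken (k + 1) H G :=
  Fin.snoc (α := fun _ => RecursionToken (k + 1) H G)
    (Fin.snoc (α := fun _ => RecursionToken (k + 1) H G) (fun i => arg i.castSucc) counter) result

theorem comp_stepSource {H G : Type} (p : RecursionToken (k + 1) H G → ℕ) :
    (fun i => p (stepSource k H G i)) =
      appendEntry (appendEntry (fun i => p (arg i.castSucc)) (p counter)) (p result) := by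
  funext i
  refine Fin.lastCases ?_ (fun i => ?_) i
  · simp [stepSource, appendEntry]
  · refine Fin.lastCases ?_ (fun i => ?_) i <;> simp [stepSource, appendEntry]

theorem stepSource_ne_step {H G : Type} (i : Fin (k + 2)) (b : G) :
    stepSource k H G i ≠ step b := by
  refine Fin.lastCases ?_ (fun i => ?_) i
  · simp [stepSource]
  · refine Fin.lastCases ?_ (fun i => ?_) i <;> simp [stepSource]

open Classical in
/-- Exit on the right if the counter has reached the recursion argument. -/
noncomputable def testCounter (k : ℕ) (H G : Type) :
    TokenProgram (RecursionToken (k + 1) H G) Unit (Unit ⊕ Unit) :=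
  visitOnce (fun _ => counter) fun _ o =>
    (if arg (Fin.last k) ∈ o.2 then Sum.inr () else Sum.inl (), Output.stay)

open Classical in
theorem exec_testCounter {H G : Type} (p : RecursionToken (k + 1) H G → ℕ) :
    (testCounter k H G).Exec () p
      (if p (arg (Fin.last k)) = p counter then Sum.inr () else Sum.inl ()) p := by
  have := exec_visitOnce (fun _ => (counter : RecursionToken (k + 1) H G))
    (fun _ o => (if arg (Fin.last k) ∈ o.2 then (Sum.inr () : Unit ⊕ Unit) else Sum.inl (),
      Output.stay)) () p
  rw [moveToken_stay] at this
  convert this using 1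
  · rfl
  · simp only [observe, Set.mem_ofPred_eq]
    congr

/-- Advance the counter. -/
def increment (k : ℕ) (H G : Type) :
    TokenProgram (RecursionToken (k + 1) H G) Unit (Unit ⊕ Unit) :=
  visitOnce (fun _ => counter) fun _ _ => (Sum.inl (), Output.port0)

/-- Iterate the second team until the counter reaches the recursion argument. -/
noncomputable def recursionLoop :
    TokenProgram (RecursionToken (k + 1) Ah.Agent Ag.Agent) Unit Unit :=
  loop ((testCounter k Ah.Agent Ag.Agent).chain (Sum.map id Sum.inr)
    ((call Ag step grpG (stepSource k Ah.Agent Ag.Agent) result).seq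
      (increment k Ah.Agent Ag.Agent)))

variable {Ag grpG} in
-- The loop invariant is that `counter` is at `j` and `result` at the value of the recursion at `j`,
-- with the arguments in place. The variant is `d`, the distance from the counter to the recursion
-- argument.
theorem exec_recursionLoop (hG : Ag.ComputesWith grpG g) {x : Fin k → ℕ} {j d : ℕ}
    {p : RecursionToken (k + 1) Ah.Agent Ag.Agent → ℕ} (hx : ∀ i, p (arg i.castSucc) = x i)
    (hc : p counter = j) (hy : p (arg (Fin.last k)) = j + d)
    (hr : p result = primitiveRecursionAux h g x j) :
    ∃ p', (recursionLoop Ah Ag grpG).Exec () p () p' ∧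
      p' result = primitiveRecursionAux h g x (j + d) := by
  classical
  have htest := exec_testCounter p
  induction d generalizing j p with
  | zero =>
    rw [if_pos (by omega)] at htest
    exact ⟨p, exec_loop_exit (exec_chain_of_exit htest rfl), hr⟩
  | succ d ih =>
    rw [if_neg (by omega)] at htest
    obtain ⟨p', h₁, h₂, h₃⟩ := exec_call Ag
      (step : Ag.Agent → RecursionToken (k + 1) Ah.Agent Ag.Agent) (fun a b => by simp) hG
      (src := stepSource k Ah.Agent Ag.Agent) (res := result)
      (fun i => by rintro ⟨b, hb⟩; exact stepSource_ne_step i b hb.symm) (by simp) p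
    have harg i : p' (arg i) = p (arg i) := h₃ _ (by simp) (by simp)
    have hcnt : p' counter = p counter := h₃ _ (by simp) (by simp)
    have hinc : (increment k Ah.Agent Ag.Agent).Exec () p' (Sum.inl ())
        (moveToken p' counter Output.port0) := exec_visitOnce_of_eq rfl
    obtain ⟨p'', h₄, h₅⟩ := ih (j := j + 1) (p := moveToken p' counter Output.port0)
      (fun i => by rw [moveToken_of_ne _ _ _ (by simp), harg, hx])
      (by rw [moveToken_self, hcnt, hc]; rfl)
      (by rw [moveToken_of_ne _ _ _ (by simp), harg, hy]; omega)
      (by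
        rw [moveToken_of_ne _ _ _ (by simp), h₂, comp_stepSource, hc, hr]
        simp [primitiveRecursionAux, hx])
      (exec_testCounter _)
    refine ⟨p'', exec_loop_again (exec_chain htest rfl (exec_seq h₁ hinc)) h₄, ?_⟩
    rw [h₅]
    congr 1
    omega

/-- Primitive recursion, executed with the help of teams for the two given functions. In the end
all tokens are at the result. -/
noncomputable def recursionProgram [Nonempty Ah.Agent] :
    TokenProgram (RecursionToken (k + 1) Ah.Agent Ag.Agent) Unit Unit :=
  have := Ah.finite_agent
  have := Ag.finite_agent
  (call Ah base grpH (fun i => arg i.castSucc) result).seq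
    ((recursionLoop Ah Ag grpG).seq
      (assignAll (fun t : {t : RecursionToken (k + 1) Ah.Agent Ag.Agent // t ≠ result} => t.1)
        fun _ => result))

variable {Ah Ag grpH grpG} in
theorem exec_recursionProgram [Nonempty Ah.Agent] (hH : Ah.ComputesWith grpH h) (hG : Ag.ComputesWith grpG g)
    {p : RecursionToken (k + 1) Ah.Agent Ag.Agent → ℕ} (hc : p counter = 0) :
    (recursionProgram Ah Ag grpH grpG).Exec () p ()
      (fun _ => primitiveRecursion h g fun i => p (arg i)) := by
  have := Ah.finite_agent
  have := Ag.finite_agent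
  obtain ⟨p₁, h₁, h₁', h₁''⟩ := exec_call Ah
    (base : Ah.Agent → RecursionToken (k + 1) Ah.Agent Ag.Agent) (fun a b => by simp) hH
    (src := fun i => arg i.castSucc) (res := result) (by simp) (by simp) p
  obtain ⟨p₂, h₂, h₂'⟩ := exec_recursionLoop (h := h) Ah hG
    (x := fun i => p (arg i.castSucc)) (j := 0) (d := p (arg (Fin.last k))) (p := p₁)
    (fun i => h₁'' _ (by simp) (by simp)) (by rw [h₁'' _ (by simp) (by simp), hc])
    (by rw [h₁'' _ (by simp) (by simp), zero_add]) h₁'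
  obtain ⟨p₃, h₃, h₃', h₃''⟩ := exec_assignAll
    (e := fun t : {t : RecursionToken (k + 1) Ah.Agent Ag.Agent // t ≠ result} => t.1)
    (src := fun _ => result) Subtype.val_injective (by simp) p₂
  have hp₃ : p₃ = fun _ => primitiveRecursion h g fun i => p (arg i) := by
    funext t
    have hres : p₂ result = primitiveRecursion h g fun i => p (arg i) := by
      rw [h₂', zero_add]; rfl
    by_cases ht : t = result
    · rw [ht, h₃'' result (by simp), hres]
    · rw [h₃' ⟨t, ht⟩, hres]
  exact exec_seq h₁ (exec_seq h₂ (hp₃ ▸ h₃))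

end recursion

end TokenProgram

open RecursionToken in
theorem theorem4p1 (k : ℕ) (hk : 1 ≤ k)
    (h : (Fin k → ℕ) → ℕ) (g : (Fin (k + 2) → ℕ) → ℕ)
    (Ah : Team) (hAh : Ah.SynchronizedComputes h)
    (Ag : Team) (hAg : Ag.SynchronizedComputes g) :
    ∃ Af : Team, Af.DisjointSlices ∧ Af.SynchronizedComputes (primitiveRecursion h g) := by
  classical
  obtain ⟨grpH, hsurjH, hH, -⟩ := hAh
  obtain ⟨grpG, hsurjG, hG, -⟩ := hAg
  -- Here `1 ≤ k` provides a group, and thus an agent.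
  have : Nonempty Ah.Agent := ⟨(hsurjH ⟨0, hk⟩).choose⟩
  have : Nonempty Ag.Agent := ⟨(hsurjG 0).choose⟩
  have := Ah.finite_agent
  have := Ag.finite_agent
  let F := TokenProgram.recursionProgram Ah Ag grpH grpG
  -- The tokens `arg i` must keep their nodes, so separate tokens `sync i` serve as synchronizers.
  -- The controller and the other tokens may start anywhere, since they go to the root first.
  let grp : Option (RecursionToken (k + 1) Ah.Agent Ag.Agent) → Fin (k + 1)
    | some (arg i) => i
    | some (sync i) => i
    | _ => 0
  refine ⟨F.toTeam (Set.range arg), F.disjointSlices_toTeam _,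
    F.synchronizedComputes_toTeam _ grp sync (fun i => ⟨by simp, rfl⟩) _ fun x => ?_⟩
  have := TokenProgram.exec_recursionProgram hH hG
    (p := fun u => if u ∈ Set.range arg then x (grp (some u)) else 0) (by simp)
  convert this using 3
  simp [grp]
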